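/- Let $d\in\mathbb N$, let $I$ be a finite set with $\#I\ge 2$, and for each $i\in I$ let $A_i\in\mathbb R^{d\times d}$ be an invertible matrix with $\|A_i\|<1$ (Euclidean operator norm). For a word $\mathtt i=(i_1,\dots,i_n)\in I^n$ put $|\mathtt i|=n$, $A_{\mathtt i}=A_{i_1}\cdots A_{i_n}$, and let $[\mathtt i]\subset I^\infty=I^{\mathbb N}$ be the set of infinite sequences that begin with $\mathtt i$. Give $I^\infty$ the product of the discrete topologies and let $\sigma(i_1,i_2,\dots)=(i_2,i_3,\dots)$. For an invertible matrix $B$ with singular values $\alpha_1(B)\ge\dots\ge\alpha_d(B)>0$ let $$\varphi^s(B)=\alpha_1(B)\cdots\alpha_k(B)\,\alpha_{k+1}(B)^{s-k}\quad(0\le s<d,\ k=\lfloor s\rfloor),\qquad \varphi^s(B)=|\det B|^{s/d}\quad(s\ge d).$$ Let $K\subset I^\infty$ be a nonempty compact set with $\sigma(K)\subset K$, let $K_n\subset I^n$ be the set of words formed by the first $n$ letters of elements of $K$, and let $K_*=\bigcup_{n\ge1}K_n$. The topological pressure is $$P_K(s)=\lim_{n\to\infty}\frac1n\log\sum_{\mathtt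 i\in K_n}\varphi^s(A_{\mathtt i})\qquad(s\ge 0),$$ and the Lyapunov exponents of a $\sigma$-invariant Borel probability measure $\mu$ on $I^\infty$ whose support is contained in $K$ are $$\lambda_k(\mu)=\lim_{n\to\infty}\frac1n\sum_{\mathtt i\in K_n}\mu([\mathtt i])\log\alpha_k(A_{\mathtt i})\qquad(1\le k\le d).$$ **Theorem.** Let $t\in(0,d)\setminus\mathbb N$, $l=\lfloor t\rfloor$ and $c\ge 1$, and let $\mu$ be a $\sigma$-invariant and ergodic Borel probability measure on $I^\infty$ whose support is contained in $K$, such that $$\mu([\mathtt i])\ \ge\ c^{-1}e^{-|\mathtt i|P_K(t)}\varphi^t(A_{\mathtt i})\qquad\text{for all }\mathtt i\in K_*.$$ Then the limits defining $P_K(s)$ for all $s\ge0$ and $\lambda_{l+1}(\mu)$ exist as real numbers, $P_K$ is differentiable at $t$, and $P_K'(t)=\lambda_{l+1}(\mu)$. -/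

import Mathlib

open Filter Topology MeasureTheory

noncomputable section

namespace SubSelfAffine

/-- The left shift `σ(i₁, i₂, …) = (i₂, i₃, …)` on the symbol space `I^∞ = (ℕ → I)`. -/
def shift {I : Type*} (x : ℕ → I) : ℕ → I := fun k => x (k + 1)

/-- The restriction `x|ₙ ∈ Iⁿ` of a symbol `x` to its first `n` letters. -/
def restrict {I : Type*} (x : ℕ → I) (n : ℕ) : Fin n → I := fun k => x k

/-- The cylinder set `[w]` of a finite word `w ∈ Iⁿ`. -/
def cylinder {I : Type*} {n : ℕ} (w : Fin n → I) : Set (ℕ → I) := {x | restrict x n = w}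

open Classical in
/-- `K_n = {x|ₙ : x ∈ K}`, the finite set of initial words of length `n` of elements of `K`. -/
def words {I : Type*} [Fintype I] (K : Set (ℕ → I)) (n : ℕ) : Finset (Fin n → I) :=
  Finset.univ.filter fun w => ∃ x ∈ K, restrict x n = w

/-- The matrix product `A_w = A_{w₁} ⋯ A_{wₙ}` along a finite word. -/
def wordProd {d : ℕ} {I : Type*} (A : I → Matrix (Fin d) (Fin d) ℝ) {n : ℕ} (w : Fin n → I) :
    Matrix (Fin d) (Fin d) ℝ :=
  (List.ofFn fun k => A (w k)).prod

/-- The `k`-th singular value `α_k(B)`, for `1 ≤ k ≤ d`, in non-increasing order and with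
multiplicity (Mathlib's `LinearMap.singularValues` is indexed from zero). -/
def singVal {d : ℕ} (B : Matrix (Fin d) (Fin d) ℝ) (k : ℕ) : ℝ :=
  (Matrix.toEuclideanLin B).singularValues (k - 1)

/-- The singular value function `φ^t(B)`, for `t ≥ 0`. -/
def svf {d : ℕ} (t : ℝ) (B : Matrix (Fin d) (Fin d) ℝ) : ℝ :=
  if t < d then
    (∏ k ∈ Finset.Icc 1 ⌊t⌋₊, singVal B k) * singVal B (⌊t⌋₊ + 1) ^ (t - (⌊t⌋₊ : ℝ))
  else |B.det| ^ (t / d)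

/-- `(1/n) log ∑_{w ∈ K_n} φ^t(A_w)`. -/
def pressureSeq {d : ℕ} {I : Type*} [Fintype I] (A : I → Matrix (Fin d) (Fin d) ℝ)
    (K : Set (ℕ → I)) (t : ℝ) (n : ℕ) : ℝ :=
  (1 / (n : ℝ)) * Real.log (∑ w ∈ words K n, svf t (wordProd A w))

/-- The topological pressure `P_K(t) = lim_n (1/n) log ∑_{w ∈ K_n} φ^t(A_w)`. -/
def pressure {d : ℕ} {I : Type*} [Fintype I] (A : I → Matrix (Fin d) (Fin d) ℝ)
    (K : Set (ℕ → I)) (t : ℝ) : ℝ :=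
  limUnder atTop (pressureSeq A K t)

/-- `(1/n) ∑_{w ∈ K_n} μ([w]) log α_k(A_w)`. -/
def lyapunovSeq {d : ℕ} {I : Type*} [Fintype I] [MeasurableSpace I]
    (A : I → Matrix (Fin d) (Fin d) ℝ) (K : Set (ℕ → I)) (μ : Measure (ℕ → I)) (k n : ℕ) : ℝ :=
  (1 / (n : ℝ)) * ∑ w ∈ words K n, μ.real (cylinder w) * Real.log (singVal (wordProd A w) k)

/-- The Lyapunov exponent `λ_k(μ) = lim_n (1/n) ∑_{w ∈ K_n} μ([w]) log α_k(A_w)`,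
for `1 ≤ k ≤ d`. -/
def lyapunov {d : ℕ} {I : Type*} [Fintype I] [MeasurableSpace I]
    (A : I → Matrix (Fin d) (Fin d) ℝ) (K : Set (ℕ → I)) (μ : Measure (ℕ → I)) (k : ℕ) : ℝ :=
  limUnder atTop (lyapunovSeq A K μ k)

end SubSelfAffine

end

/-! Write `f n x` for the logarithm of the `(⌊t⌋₊ + 1)`-th singular value of the product along
`x|ₙ`. While `t + e` keeps the integer part of `t`, `φ^{t+e}` is `φ^t` times `exp (e * f n)`.
Solving the Gibbs lower bound for `φ^t` and summing over `K_n` bounds the partition function at `t +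
e` by `c * exp (n P(t)) * ∫ exp (e * f n) dμ`. By submultiplicativity the pressure is an infimum, so
for every `n ≥ 1` n (P(t+e) - P(t)) ≤ log c + log ∫ exp (e * f n) dμ. Choose `n` of order `R / |e|`.
Then `e * f n` stays bounded, and `f n / n → λ` in L¹ makes the last term at most `n e λ + o(1)`.
Dividing by `n` leaves the error `|e| (log c + o(1)) / R`, small once `R` is large. This bounds the
increment from above for both signs of `e`; midpoint convexity at `t` (Cauchy–Schwarz) supplies the
matching lower bound.

The L¹ limit comes from a subadditive ergodic theorem applied to the logarithms of the products of
the `k` and `k + 1` largest singular values. These products are submultiplicative by a Gram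
determinant estimate. -/

namespace SubSelfAffine

/-! ### Products of singular values and Gram determinants -/

open Matrix in
-- Cauchy–Binet over all index maps instead of `k`-subsets, hence the factor `k!`. Multilinear
-- expansion yields one minor times a diagonal product; averaging over permutations of the indices
-- antisymmetrises that product into a second copy of the minor.
theorem factorial_mul_det_transpose_mul_diagonal_mul {m k : ℕ} (W : Matrix (Fin m) (Fin k) ℝ)
    (D : Fin m → ℝ) :
    (k.factorial : ℝ) * (Wᵀ * diagonal D * W).det =
      ∑ f : Fin k → Fin m, (∏ i, D (f i)) * (W.submatrix f id).det ^ 2 := by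
  have hdet : (Wᵀ * diagonal D * W).det = ∑ f : Fin k → Fin m,
      (∏ i, D (f i)) * (∏ i, W (f i) i) * (W.submatrix f id).det := by
    rw [det_apply']
    have hentry : ∀ i j, (Wᵀ * diagonal D * W) i j = ∑ a, W a i * D a * W a j := by
      intro i j
      rw [Matrix.mul_apply]
      simp only [mul_diagonal, transpose_apply]
    simp_rw [hentry, Finset.prod_univ_sum, Fintype.piFinset_univ, Finset.mul_sum]
    rw [Finset.sum_comm]
    refine Finset.sum_congr rfl fun f _ => ?_
    rw [← det_transpose, det_apply', Finset.mul_sum]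
    refine Finset.sum_congr rfl fun σ _ => ?_
    simp only [Finset.prod_mul_distrib, transpose_apply, submatrix_apply, id_eq]
    ring
  have hsymm : ∀ τ : Equiv.Perm (Fin k), (Wᵀ * diagonal D * W).det = ∑ f : Fin k → Fin m,
      (∏ i, D (f i)) * (W.submatrix f id).det *
        ((Equiv.Perm.sign τ : ℤ) * ∏ i, W (f (τ i)) i) := by
    intro τ
    rw [hdet, ← (Equiv.arrowCongr τ.symm (Equiv.refl (Fin m))).sum_comp]
    refine Finset.sum_congr rfl fun f _ => ?_
    have h1 : (W.submatrix (f ∘ τ) id).det =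
        (Equiv.Perm.sign τ : ℤ) * (W.submatrix f id).det := by
      have := det_permute τ (W.submatrix f id)
      simpa using this
    have h2 : ∏ i, D (f (τ i)) = ∏ i, D (f i) := Equiv.prod_comp τ fun i => D (f i)
    have h3 : (Equiv.arrowCongr τ.symm (Equiv.refl (Fin m))) f = f ∘ τ := by
      ext; simp [Equiv.arrowCongr]
    rw [h3, h1]
    simp only [Function.comp_apply, h2]
    ring
  calc (k.factorial : ℝ) * (Wᵀ * diagonal D * W).det
      = ∑ _τ : Equiv.Perm (Fin k), (Wᵀ * diagonal D * W).det := by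
        simp [Fintype.card_perm]
    _ = ∑ τ : Equiv.Perm (Fin k), ∑ f : Fin k → Fin m,
          (∏ i, D (f i)) * (W.submatrix f id).det *
            ((Equiv.Perm.sign τ : ℤ) * ∏ i, W (f (τ i)) i) :=
        Finset.sum_congr rfl fun τ _ => hsymm τ
    _ = _ := by
        rw [Finset.sum_comm]
        refine Finset.sum_congr rfl fun f _ => ?_
        rw [← Finset.mul_sum, sq, ← mul_assoc]
        congr 1
        rw [det_apply']
        simp

open Matrix in
-- Minors with a repeated row vanish, so only injective index maps matter; the case `D = 1`
-- evaluates the remaining sum of squared minors.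
theorem det_transpose_mul_diagonal_mul_le {m k : ℕ} (W : Matrix (Fin m) (Fin k) ℝ)
    (D : Fin m → ℝ) (C : ℝ) (hC : ∀ f : Fin k → Fin m, Function.Injective f → ∏ i, D (f i) ≤ C) :
    (Wᵀ * diagonal D * W).det ≤ C * (Wᵀ * W).det := by
  have h1 := factorial_mul_det_transpose_mul_diagonal_mul W D
  have h2 := factorial_mul_det_transpose_mul_diagonal_mul W (fun _ => 1)
  simp only [Finset.prod_const_one, one_mul, diagonal_one, Matrix.mul_one] at h2
  have hk : (0 : ℝ) < k.factorial := by positivity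
  refine le_of_mul_le_mul_left ?_ hk
  rw [h1, mul_left_comm, h2, Finset.mul_sum]
  refine Finset.sum_le_sum fun f _ => ?_
  by_cases hf : Function.Injective f
  · exact mul_le_mul_of_nonneg_right (hC f hf) (sq_nonneg _)
  · obtain ⟨i, j, hij, hne⟩ : ∃ i j, f i = f j ∧ i ≠ j := by
      simpa [Function.Injective] using hf
    have : (W.submatrix f id).det = 0 :=
      det_zero_of_row_eq hne (by ext a; simp [hij])
    simp [this]

theorem prod_comp_le_prod_range_of_antitone {a : ℕ → ℝ} (ha : Antitone a) (h0 : ∀ i, 0 ≤ a i)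
    {k : ℕ} (f : Fin k → ℕ) (hf : Function.Injective f) :
    ∏ i, a (f i) ≤ ∏ i ∈ Finset.range k, a i := by
  classical
  set s := Finset.univ.image f
  have hs : s.card = k := by
    rw [Finset.card_image_of_injective _ hf, Finset.card_univ, Fintype.card_fin]
  have h1 : ∏ i, a (f i) = ∏ x ∈ s, a x := (Finset.prod_image fun x _ y _ h => hf h).symm
  have h2 : ∏ x ∈ s, a x = ∏ i : Fin k, a (s.orderEmbOfFin hs i) := by
    rw [← Finset.prod_image (s := Finset.univ) (g := s.orderEmbOfFin hs)
      fun x _ y _ h => (s.orderEmbOfFin hs).injective h, Finset.image_orderEmbOfFin_univ]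
  rw [h1, h2, Finset.prod_range]
  refine Finset.prod_le_prod (fun i _ => h0 _) fun i _ => ha ?_
  have hmono : StrictMono (s.orderEmbOfFin hs) := (s.orderEmbOfFin hs).strictMono
  -- In increasing order, the `i`-th element of a set of naturals is at least `i`.
  obtain ⟨i, hi⟩ := i
  induction i with
  | zero => exact Nat.zero_le _
  | succ j ih =>
    have hj : j ≤ s.orderEmbOfFin hs ⟨j, by omega⟩ := ih (by omega) (Finset.mem_univ _)
    have : s.orderEmbOfFin hs ⟨j, by omega⟩ < s.orderEmbOfFin hs ⟨j + 1, hi⟩ :=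
      hmono (by simp [Fin.lt_def])
    exact hj.trans_lt this

/-- The product of the `k` largest singular values. -/
noncomputable def svProd {d : ℕ} (k : ℕ) (B : Matrix (Fin d) (Fin d) ℝ) : ℝ :=
  ∏ i ∈ Finset.range k, (Matrix.toEuclideanLin B).singularValues i

open Matrix in
theorem exists_orthogonal_diagonalization {d : ℕ} (B : Matrix (Fin d) (Fin d) ℝ) :
    ∃ U : Matrix (Fin d) (Fin d) ℝ, Uᵀ * U = 1 ∧
      (B * U)ᵀ * (B * U) =
        diagonal fun i : Fin d => (Matrix.toEuclideanLin B).singularValues i ^ 2 := by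
  set T := Matrix.toEuclideanLin B
  have hn : Module.finrank ℝ (EuclideanSpace ℝ (Fin d)) = d := by simp
  have hT := T.isSymmetric_adjoint_comp_self
  set e := hT.eigenvectorBasis hn
  refine ⟨Matrix.of fun a i => e i a, ?_, ?_⟩
  · ext i j
    have := orthonormal_iff_ite.mp e.orthonormal i j
    rw [EuclideanSpace.inner_eq_star_dotProduct] at this
    simp only [Matrix.mul_apply, transpose_apply, of_apply, Matrix.one_apply]
    rw [← this]
    simp [dotProduct, mul_comm]
  · ext i j
    have h1 : inner ℝ (T (e i)) (T (e j)) = if i = j then T.singularValues i ^ 2 else 0 := by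
      rw [← LinearMap.adjoint_inner_left]
      have h2 := hT.apply_eigenvectorBasis hn i
      simp only [LinearMap.comp_apply] at h2
      rw [h2, real_inner_smul_left, orthonormal_iff_ite.mp e.orthonormal i j,
        T.sq_singularValues_fin hn i]
      simp
    rw [EuclideanSpace.inner_eq_star_dotProduct] at h1
    rw [diagonal_apply, ← h1]
    simp only [Matrix.mul_apply, transpose_apply, of_apply, dotProduct]
    refine Finset.sum_congr rfl fun a _ => ?_
    exact mul_comm _ _

theorem svProd_nonneg {d : ℕ} (k : ℕ) (B : Matrix (Fin d) (Fin d) ℝ) : 0 ≤ svProd k B :=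
  Finset.prod_nonneg fun _ _ => LinearMap.singularValues_nonneg _ _

open Matrix in
theorem det_gram_mul_le {d k : ℕ} (B : Matrix (Fin d) (Fin d) ℝ) (W : Matrix (Fin d) (Fin k) ℝ) :
    ((B * W)ᵀ * (B * W)).det ≤ svProd k B ^ 2 * (Wᵀ * W).det := by
  obtain ⟨U, hU, hD⟩ := exists_orthogonal_diagonalization B
  have hU' : U * Uᵀ = 1 := mul_eq_one_comm.mp hU
  have hW : W = U * (Uᵀ * W) := by rw [← Matrix.mul_assoc, hU', Matrix.one_mul]
  have h1 : (B * W)ᵀ * (B * W) = (Uᵀ * W)ᵀ * ((B * U)ᵀ * (B * U)) * (Uᵀ * W) := by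
    conv_lhs => rw [hW]
    simp only [transpose_mul, Matrix.mul_assoc]
  have h2 : Wᵀ * W = (Uᵀ * W)ᵀ * (Uᵀ * W) := by
    conv_lhs => rw [hW]
    rw [transpose_mul U, Matrix.mul_assoc, ← Matrix.mul_assoc Uᵀ U, hU, Matrix.one_mul]
  rw [h1, h2, hD]
  refine det_transpose_mul_diagonal_mul_le _ _ _ fun f hf => ?_
  rw [Finset.prod_pow]
  refine pow_le_pow_left₀ (Finset.prod_nonneg fun _ _ => LinearMap.singularValues_nonneg _ _) ?_ 2
  exact prod_comp_le_prod_range_of_antitone (LinearMap.singularValues_antitone _)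
    (LinearMap.singularValues_nonneg _) (fun i => (f i : ℕ)) (Fin.val_injective.comp hf)

open Matrix in
-- Submultiplicativity of the norm on the `k`-th exterior power, phrased with volumes: on the top
-- `k` right singular vectors of `A * B` the Gram determinant equals the square of the left side,
-- and `det_gram_mul_le` peels off `A` and then `B`.
theorem svProd_mul_le {d k : ℕ} (hk : k ≤ d) (A B : Matrix (Fin d) (Fin d) ℝ) :
    svProd k (A * B) ≤ svProd k A * svProd k B := by
  obtain ⟨U, hU, hD⟩ := exists_orthogonal_diagonalization (A * B)
  set W := U.submatrix id (Fin.castLE hk)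
  have hinj : Function.Injective (Fin.castLE hk) := Fin.castLE_injective hk
  have hW : Wᵀ * W = 1 := by
    have : Wᵀ * W = (Uᵀ * U).submatrix (Fin.castLE hk) (Fin.castLE hk) := by
      ext; simp [W, Matrix.mul_apply]
    rw [this, hU, submatrix_one _ hinj]
  have hABW : ((A * B * W)ᵀ * (A * B * W)).det = svProd k (A * B) ^ 2 := by
    have : (A * B * W)ᵀ * (A * B * W) =
        ((A * B * U)ᵀ * (A * B * U)).submatrix (Fin.castLE hk) (Fin.castLE hk) := by
      ext; simp [W, Matrix.mul_apply]
    rw [this, hD, submatrix_diagonal _ _ hinj, det_diagonal, svProd, ← Finset.prod_pow,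
      Finset.prod_range]
    rfl
  refine le_of_sq_le_sq ?_ (mul_nonneg (svProd_nonneg k A) (svProd_nonneg k B))
  calc svProd k (A * B) ^ 2 = ((A * (B * W))ᵀ * (A * (B * W))).det := by
        rw [← hABW, Matrix.mul_assoc A B W]
    _ ≤ svProd k A ^ 2 * ((B * W)ᵀ * (B * W)).det := det_gram_mul_le A (B * W)
    _ ≤ svProd k A ^ 2 * (svProd k B ^ 2 * (Wᵀ * W).det) :=
        mul_le_mul_of_nonneg_left (det_gram_mul_le B W) (sq_nonneg _)
    _ = (svProd k A * svProd k B) ^ 2 := by rw [hW, det_one]; ring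

open Matrix in
theorem svProd_card_eq_abs_det {d : ℕ} (B : Matrix (Fin d) (Fin d) ℝ) : svProd d B = |B.det| := by
  obtain ⟨U, hU, hD⟩ := exists_orthogonal_diagonalization B
  have h1 : U.det * U.det = 1 := by simpa using congrArg det hU
  have h2 := congrArg det hD
  rw [det_diagonal, Finset.prod_pow, det_mul, det_transpose, det_mul] at h2
  have h3 : (∏ i : Fin d, (Matrix.toEuclideanLin B).singularValues i) = svProd d B := by
    rw [svProd, Finset.prod_range]
  rw [h3] at h2
  have h4 : svProd d B ^ 2 = |B.det| ^ 2 := by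
    rw [sq_abs, ← h2]
    linear_combination B.det ^ 2 * h1
  exact (sq_eq_sq₀ (svProd_nonneg d B) (abs_nonneg _)).mp h4

theorem svProd_succ {d : ℕ} (k : ℕ) (B : Matrix (Fin d) (Fin d) ℝ) :
    svProd (k + 1) B = svProd k B * singVal B (k + 1) := by
  rw [svProd, svProd, Finset.prod_range_succ, singVal, Nat.add_sub_cancel]

theorem svf_of_lt {d : ℕ} {t : ℝ} (ht : t < d) (B : Matrix (Fin d) (Fin d) ℝ) :
    svf t B = svProd ⌊t⌋₊ B * singVal B (⌊t⌋₊ + 1) ^ (t - (⌊t⌋₊ : ℝ)) := by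
  rw [svf, if_pos ht, svProd, Finset.range_eq_Ico]
  congr 1
  rw [← Finset.Ico_add_one_right_eq_Icc, Finset.prod_Ico_eq_prod_range, Nat.add_sub_cancel,
    Finset.range_eq_Ico]
  exact Finset.prod_congr rfl fun i _ => by rw [singVal, Nat.add_sub_cancel_left]

theorem singularValues_zero_le_one {d : ℕ} (B : Matrix (Fin d) (Fin d) ℝ)
    (hB : ‖Matrix.toEuclideanCLM (n := Fin d) (𝕜 := ℝ) B‖ ≤ 1) :
    (Matrix.toEuclideanLin B).singularValues 0 ≤ 1 := by
  set T := Matrix.toEuclideanLin B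
  rcases Nat.eq_zero_or_pos d with hd | hd
  · rw [T.singularValues_of_finrank_le (by simp [hd])]
    exact zero_le_one
  obtain ⟨v, hv⟩ := (T.hasEigenvalue_adjoint_comp_self_sq_singularValues
    (n := 0) (by simpa using hd)).exists_hasEigenvector
  have h1 : LinearMap.adjoint T (T v) = T.singularValues 0 ^ 2 • v := hv.apply_eq_smul
  have h2 : ‖T v‖ ^ 2 = T.singularValues 0 ^ 2 * ‖v‖ ^ 2 := by
    rw [← real_inner_self_eq_norm_sq, ← LinearMap.adjoint_inner_left, h1, real_inner_smul_left,
      real_inner_self_eq_norm_sq]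
  have h3 : ‖T v‖ ≤ ‖v‖ := by
    have := (Matrix.toEuclideanCLM (n := Fin d) (𝕜 := ℝ) B).le_of_opNorm_le hB v
    rw [one_mul] at this
    exact this
  have hv0 : 0 < ‖v‖ := norm_pos_iff.mpr hv.2
  have h4 : T.singularValues 0 ^ 2 ≤ 1 := by
    refine le_of_mul_le_mul_right ?_ (pow_pos hv0 2)
    rw [← h2, one_mul]
    exact pow_le_pow_left₀ (norm_nonneg _) h3 2
  exact (sq_le_one_iff₀ (T.singularValues_nonneg 0)).mp h4

/-! ### Mean and subadditive ergodic theorems in L¹ -/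

/-- Von Neumann's theorem in L²: the limit is the projection onto invariant functions, which are
constants by ergodicity. On a probability space the L¹ norm is at most the L² norm. -/
theorem _root_.Ergodic.tendsto_integral_abs_birkhoffAverage_sub {Ω : Type*} [MeasurableSpace Ω]
    {μ : Measure Ω} [IsProbabilityMeasure μ] {T : Ω → Ω} (hT : Ergodic T μ) {h : Ω → ℝ}
    (hh : MemLp h 2 μ) :
    Tendsto (fun n => ∫ x, |birkhoffAverage ℝ T h n x - ∫ y, h y ∂μ| ∂μ) atTop (𝓝 0) := by
  have hmp := hT.toMeasurePreserving
  set f : Lp ℝ 2 μ →ₗᵢ[ℝ] Lp ℝ 2 μ := Lp.compMeasurePreservingₗᵢ ℝ T hmp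
  set F : Lp ℝ 2 μ →L[ℝ] Lp ℝ 2 μ := f.toContinuousLinearMap
  have hFn : ‖F‖ ≤ 1 := f.norm_toContinuousLinearMap_le
  have hlim := F.tendsto_birkhoffAverage_orthogonalProjection hFn (hh.toLp h)
  set p := ((F.eqLocus (1 : Lp ℝ 2 μ →L[ℝ] Lp ℝ 2 μ)).orthogonalProjectionOnto (hh.toLp h))
  have hp : Lp.compMeasurePreserving T hmp (p : Lp ℝ 2 μ) = (p : Lp ℝ 2 μ) := p.2
  obtain ⟨c, hc⟩ : ∃ c, (p : Lp ℝ 2 μ) =ᵐ[μ] Function.const Ω c := by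
    refine hT.ae_eq_const_of_ae_eq_comp_ae (Lp.aestronglyMeasurable _) ?_
    have := Lp.coeFn_compMeasurePreserving (p : Lp ℝ 2 μ) hmp
    rw [hp] at this
    exact this.symm
  have hiter : ∀ n, MemLp (fun x => h (T^[n] x)) 2 μ := fun n =>
    hh.comp_measurePreserving (hmp.iterate n)
  have hFiter : ∀ n, (F^[n] (hh.toLp h) : Lp ℝ 2 μ) =ᵐ[μ] fun x => h (T^[n] x) := by
    intro n
    have h1 : F^[n] (hh.toLp h) = Lp.compMeasurePreserving T^[n] (hmp.iterate n) (hh.toLp h) := by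
      exact congrFun (Lp.compMeasurePreserving_iterate hmp n) _
    rw [h1, Lp.toLp_compMeasurePreserving]
    exact MemLp.coeFn_toLp _
  have hsum : ∀ n, (birkhoffSum F _root_.id n (hh.toLp h) : Lp ℝ 2 μ) =ᵐ[μ]
      birkhoffSum T h n := by
    intro n
    induction n with
    | zero =>
      simp only [birkhoffSum_zero]
      exact Lp.coeFn_zero _ _ _
    | succ n ih =>
      rw [birkhoffSum_succ]
      filter_upwards [ih, hFiter n, Lp.coeFn_add (birkhoffSum F _root_.id n (hh.toLp h))
        (F^[n] (hh.toLp h))] with x h1 h2 h3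
      rw [id_eq, h3, Pi.add_apply, h1, h2, birkhoffSum_succ]
  have havg : ∀ n, (birkhoffAverage ℝ F _root_.id n (hh.toLp h) : Lp ℝ 2 μ) =ᵐ[μ]
      birkhoffAverage ℝ T h n := by
    intro n
    filter_upwards [hsum n, Lp.coeFn_smul ((n : ℝ)⁻¹) (birkhoffSum F _root_.id n (hh.toLp h))]
      with x h1 h2
    rw [birkhoffAverage, h2, Pi.smul_apply, h1, birkhoffAverage]
  have hAmem : ∀ n, MemLp (birkhoffAverage ℝ T h n) 2 μ := fun n =>
    (memLp_congr_ae (havg n)).mp (Lp.memLp _)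
  have hdiff : ∀ n, ∫ x, |birkhoffAverage ℝ T h n x - c| ∂μ ≤
      ‖birkhoffAverage ℝ F _root_.id n (hh.toLp h) - (p : Lp ℝ 2 μ)‖ := by
    intro n
    have hcm : MemLp (fun x => birkhoffAverage ℝ T h n x - c) 2 μ := (hAmem n).sub (memLp_const c)
    have hae : (birkhoffAverage ℝ F _root_.id n (hh.toLp h) - (p : Lp ℝ 2 μ) : Lp ℝ 2 μ) =ᵐ[μ]
        fun x => birkhoffAverage ℝ T h n x - c := by
      filter_upwards [havg n, hc, Lp.coeFn_sub (birkhoffAverage ℝ F _root_.id n (hh.toLp h))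
        (p : Lp ℝ 2 μ)] with x h1 h2 h3
      rw [h3, Pi.sub_apply, h1, h2, Function.const_apply]
    rw [Lp.norm_def, eLpNorm_congr_ae hae]
    have h1 : eLpNorm (fun x => birkhoffAverage ℝ T h n x - c) 1 μ ≤
        eLpNorm (fun x => birkhoffAverage ℝ T h n x - c) 2 μ :=
      eLpNorm_le_eLpNorm_of_exponent_le (by norm_num) hcm.1
    have h2 : ∫ x, |birkhoffAverage ℝ T h n x - c| ∂μ =
        (eLpNorm (fun x => birkhoffAverage ℝ T h n x - c) 1 μ).toReal := by
      rw [eLpNorm_one_eq_lintegral_enorm, ← integral_norm_eq_lintegral_enorm hcm.1]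
      rfl
    rw [h2]
    exact ENNReal.toReal_mono hcm.eLpNorm_ne_top h1
  have hlim0 : Tendsto (fun n => ∫ x, |birkhoffAverage ℝ T h n x - c| ∂μ) atTop (𝓝 0) :=
    squeeze_zero (fun n => integral_nonneg fun x => abs_nonneg _) hdiff
      (tendsto_iff_norm_sub_tendsto_zero.mp hlim)
  have hint : ∀ n, Integrable (birkhoffAverage ℝ T h n) μ := fun n =>
    (hAmem n).integrable (by norm_num)
  have hinteg : ∀ n, n ≠ 0 → ∫ x, birkhoffAverage ℝ T h n x ∂μ = ∫ y, h y ∂μ := by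
    intro n hn
    have hn' : (n : ℝ) ≠ 0 := Nat.cast_ne_zero.mpr hn
    have : ∀ j, ∫ x, h (T^[j] x) ∂μ = ∫ y, h y ∂μ := by
      intro j
      have hj := hmp.iterate j
      have hsm : AEStronglyMeasurable h (μ.map T^[j]) := by rw [hj.map_eq]; exact hh.1
      rw [← integral_map hj.aemeasurable hsm, hj.map_eq]
    simp only [birkhoffAverage, birkhoffSum, smul_eq_mul]
    rw [integral_const_mul, integral_finsetSum _ fun j _ => (hiter j).integrable (by norm_num)]
    simp only [this, Finset.sum_const, Finset.card_range, nsmul_eq_mul]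
    field_simp
  -- Every nontrivial average has integral `∫ h`, and integrals pass to the L¹ limit.
  have hceq : ∫ y, h y ∂μ = c := by
    have h1 : ∀ n, n ≠ 0 → |(∫ y, h y ∂μ) - c| ≤ ∫ x, |birkhoffAverage ℝ T h n x - c| ∂μ := by
      intro n hn
      have : (∫ y, h y ∂μ) - c = ∫ x, (birkhoffAverage ℝ T h n x - c) ∂μ := by
        rw [integral_sub (hint n) (integrable_const c), hinteg n hn]
        simp
      rw [this]
      exact abs_integral_le_integral_abs
    have h2 : |(∫ y, h y ∂μ) - c| ≤ 0 :=
      ge_of_tendsto hlim0 ((eventually_ne_atTop 0).mono h1)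
    exact sub_eq_zero.mp (abs_nonpos_iff.mp h2)
  rw [hceq]
  exact hlim0

/-- Averages over the `m` possible offsets of a partition into blocks of length `m`. The three
errors `C * m ^ 2` come from the initial block, from replacing `g (n + r)` by `g (n + m)`, and from
extending the Birkhoff sum to `n + m`. -/
theorem le_birkhoffSum_of_subadditive {Ω : Type*} {T : Ω → Ω} {g : ℕ → Ω → ℝ} {C : ℝ}
    (hb : ∀ n x, |g n x| ≤ C * n)
    (hs : ∀ m n x, g (m + n) x ≤ g m x + g n (T^[m] x)) (m n : ℕ) (x : Ω) :
    m * g (n + m) x ≤ birkhoffSum T (g m) (n + m) x + 3 * (C * m ^ 2) := by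
  have hC : 0 ≤ C := by simpa using (abs_nonneg _).trans (hb 1 x)
  have htel : ∀ n, ∑ r ∈ Finset.range m, g (n + r) x ≤
      birkhoffSum T (g m) n x + ∑ r ∈ Finset.range m, g r x := by
    intro n
    induction n with
    | zero => simp
    | succ n ih =>
      have h1 : ∑ r ∈ Finset.range m, g (n + 1 + r) x + g n x =
          ∑ r ∈ Finset.range m, g (n + r) x + g (n + m) x := by
        rw [← Finset.sum_range_succ, Finset.sum_range_succ', add_zero]
        exact congrArg (· + g n x) (Finset.sum_congr rfl fun r _ => by rw [add_assoc, add_comm 1 r])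
      have h2 := hs n m x
      rw [birkhoffSum_succ]
      linarith
  have h0 : ∑ r ∈ Finset.range m, g r x ≤ C * m ^ 2 := by
    have : ∀ r ∈ Finset.range m, g r x ≤ C * m := fun r hr =>
      (le_abs_self _).trans ((hb r x).trans (mul_le_mul_of_nonneg_left
        (Nat.cast_le.mpr (Finset.mem_range.mp hr).le) hC))
    refine (Finset.sum_le_sum this).trans (le_of_eq ?_)
    simp only [Finset.sum_const, Finset.card_range, nsmul_eq_mul]
    ring
  have h1 : m * g (n + m) x ≤ ∑ r ∈ Finset.range m, g (n + r) x + C * m ^ 2 := by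
    have : ∀ r ∈ Finset.range m, g (n + m) x ≤ g (n + r) x + C * m := by
      intro r hr
      have hr' := (Finset.mem_range.mp hr).le
      have ha := hs (n + r) (m - r) x
      rw [show n + r + (m - r) = n + m by omega] at ha
      have hb' := (le_abs_self _).trans (hb (m - r) (T^[n + r] x))
      have : C * ((m - r : ℕ) : ℝ) ≤ C * m :=
        mul_le_mul_of_nonneg_left (Nat.cast_le.mpr (Nat.sub_le m r)) hC
      linarith
    have h2 := Finset.sum_le_sum this
    simp only [Finset.sum_const, Finset.card_range, nsmul_eq_mul, Finset.sum_add_distrib] at h2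
    linarith
  have h2 : birkhoffSum T (g m) n x ≤ birkhoffSum T (g m) (n + m) x + C * m ^ 2 := by
    rw [birkhoffSum_add]
    have : ∀ j ∈ Finset.range m, -(C * m) ≤ g m (T^[j] (T^[n] x)) := fun j _ =>
      (abs_le.mp (hb m _)).1
    have h3 := Finset.sum_le_sum this
    simp only [Finset.sum_const, Finset.card_range, nsmul_eq_mul] at h3
    rw [birkhoffSum.eq_1 T (g m) m]
    linarith
  linarith [htel n]

/-- Kingman's theorem in L¹ for bounded increments. Fekete's lemma gives the constant; the block
estimate controls `g n / n` pointwise from above, and the lower deviation follows by comparing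
integrals. -/
theorem _root_.Ergodic.exists_tendsto_integral_abs_sub_of_subadditive {Ω : Type*}
    [MeasurableSpace Ω] {μ : Measure Ω} [IsProbabilityMeasure μ] {T : Ω → Ω} (hT : Ergodic T μ)
    {g : ℕ → Ω → ℝ} (hm : ∀ n, Measurable (g n)) {C : ℝ} (hb : ∀ n x, |g n x| ≤ C * n)
    (hs : ∀ m n x, g (m + n) x ≤ g m x + g n (T^[m] x)) :
    ∃ γ, Tendsto (fun n => ∫ x, |g n x / n - γ| ∂μ) atTop (𝓝 0) := by
  have hC : 0 ≤ C := by
    obtain ⟨x⟩ : Nonempty Ω := nonempty_of_isProbabilityMeasure μ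
    simpa using (abs_nonneg _).trans (hb 1 x)
  have hmem : ∀ n, MemLp (g n) 2 μ := fun n =>
    MemLp.of_bound (hm n).aestronglyMeasurable (C * n) (ae_of_all _ fun x => hb n x)
  have hint : ∀ n, Integrable (g n) μ := fun n => (hmem n).integrable (by norm_num)
  have hTi : ∀ j n, ∫ x, g n (T^[j] x) ∂μ = ∫ y, g n y ∂μ := by
    intro j n
    have hj := hT.toMeasurePreserving.iterate j
    rw [← integral_map hj.aemeasurable (by rw [hj.map_eq]; exact (hmem n).1), hj.map_eq]
  have hsub : Subadditive fun n => ∫ x, g n x ∂μ := by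
    intro m n
    have hi : Integrable (fun x => g n (T^[m] x)) μ :=
      ((hmem n).comp_measurePreserving (hT.toMeasurePreserving.iterate m)).integrable
        (by norm_num)
    have := integral_mono (hint (m + n)) ((hint m).add hi) (hs m n)
    simp only [Pi.add_apply] at this
    rwa [integral_add (hint m) hi, hTi] at this
  have hbdd : BddBelow (Set.range fun n : ℕ => (∫ x, g n x ∂μ) / n) := by
    refine ⟨-C, ?_⟩
    rintro _ ⟨n, rfl⟩
    rcases Nat.eq_zero_or_pos n with rfl | hn
    · simpa using hC
    · have hn' : (0 : ℝ) < n := Nat.cast_pos.mpr hn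
      rw [le_div_iff₀ hn']
      have := integral_mono (integrable_const (-(C * n))) (hint n)
        fun x => (abs_le.mp (hb n x)).1
      simp only [integral_const, probReal_univ, one_smul] at this
      linarith
  set γ := hsub.lim
  have hγle : ∀ n : ℕ, n ≠ 0 → γ ≤ (∫ x, g n x ∂μ) / n := fun n hn => hsub.lim_le_div hbdd hn
  have hγlim : Tendsto (fun n : ℕ => (∫ x, g n x ∂μ) / n) atTop (𝓝 γ) := hsub.tendsto_lim hbdd
  refine ⟨γ, ?_⟩
  rw [Metric.tendsto_atTop]
  intro ε hε
  obtain ⟨m, hmε, hm0⟩ : ∃ m : ℕ, (∫ x, g m x ∂μ) / m < γ + ε / 8 ∧ m ≠ 0 :=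
    ((hγlim.eventually (gt_mem_nhds (by linarith))).and (eventually_ne_atTop 0)).exists
  have hmpos : (0 : ℝ) < m := Nat.cast_pos.mpr (Nat.pos_of_ne_zero hm0)
  have hB := hT.tendsto_integral_abs_birkhoffAverage_sub (hmem m)
  have hBε := hB.eventually (gt_mem_nhds (show (0 : ℝ) < ε / 8 by linarith))
  have hE : Tendsto (fun n : ℕ => 3 * (C * m) / (n : ℝ)) atTop (𝓝 0) :=
    tendsto_const_div_atTop_nhds_zero_nat _
  have hEε := hE.eventually (gt_mem_nhds (show (0 : ℝ) < ε / 8 by linarith))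
  obtain ⟨N, hN⟩ := eventually_atTop.mp (hBε.and (hEε.and (eventually_ge_atTop (m + 1))))
  refine ⟨N, fun n hn => ?_⟩
  obtain ⟨h1, h2, h3⟩ := hN n hn
  have hnpos : (0 : ℝ) < n := Nat.cast_pos.mpr (by omega)
  have hm1 : (1 : ℝ) ≤ m := by exact_mod_cast Nat.pos_of_ne_zero hm0
  have hAint : Integrable (fun x => |birkhoffAverage ℝ T (g m) n x - ∫ y, g m y ∂μ|) μ := by
    have : Integrable (fun x => (n : ℝ)⁻¹ * ∑ j ∈ Finset.range n, g m (T^[j] x)) μ := by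
      refine Integrable.const_mul (integrable_finsetSum _ fun j _ => ?_) _
      exact ((hmem m).comp_measurePreserving (hT.toMeasurePreserving.iterate j)).integrable
        (by norm_num)
    exact (this.sub (integrable_const _)).abs
  -- If `u ≤ v` and `0 ≤ v` then `|u| ≤ 2 * v - u`. Here `∫ u ≥ 0` because `γ` is an infimum, and
  -- `v` has three terms contributing less than `ε / 8` each.
  have hpt : ∀ x, |g n x / n - γ| ≤ 2 * (|birkhoffAverage ℝ T (g m) n x - ∫ y, g m y ∂μ| +
      (3 * (C * m) / n + ((∫ x, g m x ∂μ) / m - γ))) - (g n x / n - γ) := by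
    intro x
    have h4 := le_birkhoffSum_of_subadditive hb hs m (n - m) x
    rw [Nat.sub_add_cancel (by omega)] at h4
    have h5 : birkhoffSum T (g m) n x = n * birkhoffAverage ℝ T (g m) n x := by
      rw [birkhoffAverage, smul_eq_mul]
      field_simp
    have h6 : g n x / n ≤ birkhoffAverage ℝ T (g m) n x / m + 3 * (C * m) / n := by
      rw [div_add_div _ _ hmpos.ne' hnpos.ne', div_le_div_iff₀ hnpos (by positivity)]
      rw [h5] at h4
      nlinarith
    have h7 : birkhoffAverage ℝ T (g m) n x / m - (∫ x, g m x ∂μ) / m ≤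
        |birkhoffAverage ℝ T (g m) n x - ∫ y, g m y ∂μ| := by
      rw [← sub_div]
      refine (div_le_div_of_nonneg_right (le_abs_self _) hmpos.le).trans ?_
      exact div_le_self (abs_nonneg _) hm1
    have h8 := hγle m hm0
    have h9 : 0 ≤ 3 * (C * m) / n := by positivity
    have h10 := abs_nonneg (birkhoffAverage ℝ T (g m) n x - ∫ y, g m y ∂μ)
    rw [abs_le']
    constructor <;> linarith
  have hgi : Integrable (fun x => g n x / n - γ) μ :=
    ((hint n).div_const _).sub (integrable_const _)
  have hAint2 : Integrable (fun x => 2 * (|birkhoffAverage ℝ T (g m) n x - ∫ y, g m y ∂μ| +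
      (3 * (C * m) / n + ((∫ x, g m x ∂μ) / m - γ)))) μ :=
    (hAint.add (integrable_const _)).const_mul 2
  have hfin := integral_mono hgi.abs (hAint2.sub hgi) hpt
  rw [integral_sub' hAint2 hgi, integral_const_mul, integral_add hAint (integrable_const _),
    integral_sub ((hint n).div_const _) (integrable_const _), integral_div] at hfin
  simp only [integral_const, probReal_univ, one_smul] at hfin
  have h8 := hγle n (by omega)
  rw [Real.dist_eq, sub_zero, abs_of_nonneg (integral_nonneg fun x => abs_nonneg _)]
  linarith

/-! ### The singular value function and bounds along words -/

theorem singularValues_pos {d : ℕ} {B : Matrix (Fin d) (Fin d) ℝ} (hB : IsUnit B) {j : ℕ}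
    (hj : j < d) : 0 < (Matrix.toEuclideanLin B).singularValues j := by
  refine (LinearMap.singularValues_nonneg _ j).lt_of_ne' ?_
  have h : svProd d B ≠ 0 := by
    rw [svProd_card_eq_abs_det, abs_ne_zero]
    exact ((Matrix.isUnit_iff_isUnit_det B).mp hB).ne_zero
  exact Finset.prod_ne_zero_iff.mp h j (Finset.mem_range.mpr hj)

theorem svProd_pos {d : ℕ} {B : Matrix (Fin d) (Fin d) ℝ} (hB : IsUnit B) {k : ℕ}
    (hk : k ≤ d) : 0 < svProd k B :=
  Finset.prod_pos fun _ hj => singularValues_pos hB ((Finset.mem_range.mp hj).trans_le hk)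

theorem singVal_pos {d : ℕ} {B : Matrix (Fin d) (Fin d) ℝ} (hB : IsUnit B) {k : ℕ}
    (hk : k < d) : 0 < singVal B (k + 1) :=
  singularValues_pos hB hk

theorem svf_pos {d : ℕ} {B : Matrix (Fin d) (Fin d) ℝ} (hB : IsUnit B) {s : ℝ} (hs : 0 ≤ s) :
    0 < svf s B := by
  by_cases h : s < d
  · have hl : ⌊s⌋₊ < d := (Nat.floor_lt hs).mpr h
    rw [svf_of_lt h]
    exact mul_pos (svProd_pos hB hl.le) (Real.rpow_pos_of_pos (singVal_pos hB hl) _)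
  · rw [svf, if_neg h]
    exact Real.rpow_pos_of_pos
      (abs_pos.mpr ((Matrix.isUnit_iff_isUnit_det B).mp hB).ne_zero) _

/-- A geometric interpolation with nonnegative exponents, through which submultiplicativity passes
from `svProd` to `svf`. -/
theorem svf_eq_rpow_mul_rpow {d : ℕ} {B : Matrix (Fin d) (Fin d) ℝ} (hB : IsUnit B) {s : ℝ}
    (hs : 0 ≤ s) (h : s < d) :
    svf s B = svProd ⌊s⌋₊ B ^ (1 - (s - (⌊s⌋₊ : ℝ))) * svProd (⌊s⌋₊ + 1) B ^ (s - (⌊s⌋₊ : ℝ)) := by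
  have hl : ⌊s⌋₊ < d := (Nat.floor_lt hs).mpr h
  have h1 := svProd_pos hB hl.le
  have h2 := singVal_pos hB hl
  rw [svf_of_lt h, svProd_succ, Real.mul_rpow h1.le h2.le, ← mul_assoc, ← Real.rpow_add h1,
    sub_add_cancel, Real.rpow_one]

theorem svf_mul_le {d : ℕ} {A B : Matrix (Fin d) (Fin d) ℝ} (hA : IsUnit A) (hB : IsUnit B)
    {s : ℝ} (hs : 0 ≤ s) : svf s (A * B) ≤ svf s A * svf s B := by
  by_cases h : s < d
  · have hl : ⌊s⌋₊ < d := (Nat.floor_lt hs).mpr h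
    have hθ : 0 ≤ s - (⌊s⌋₊ : ℝ) := sub_nonneg.mpr (Nat.floor_le hs)
    have hθ' : 0 ≤ 1 - (s - (⌊s⌋₊ : ℝ)) := by linarith [Nat.lt_floor_add_one s]
    rw [svf_eq_rpow_mul_rpow (hA.mul hB) hs h, svf_eq_rpow_mul_rpow hA hs h,
      svf_eq_rpow_mul_rpow hB hs h, mul_mul_mul_comm,
      ← Real.mul_rpow (svProd_nonneg _ _) (svProd_nonneg _ _),
      ← Real.mul_rpow (svProd_nonneg _ _) (svProd_nonneg _ _)]
    exact mul_le_mul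
      (Real.rpow_le_rpow (svProd_nonneg _ _) (svProd_mul_le hl.le A B) hθ')
      (Real.rpow_le_rpow (svProd_nonneg _ _) (svProd_mul_le hl A B) hθ)
      (Real.rpow_nonneg (svProd_nonneg _ _) _)
      (Real.rpow_nonneg (mul_nonneg (svProd_nonneg _ _) (svProd_nonneg _ _)) _)
  · simp only [svf, if_neg h]
    rw [Matrix.det_mul, abs_mul, Real.mul_rpow (abs_nonneg _) (abs_nonneg _)]

theorem svf_add_eq {d : ℕ} {B : Matrix (Fin d) (Fin d) ℝ} (hB : IsUnit B) {t e : ℝ} (ht : 0 ≤ t)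
    (htd : t < d) (hed : t + e < d) (hfl : ⌊t + e⌋₊ = ⌊t⌋₊) :
    svf (t + e) B = svf t B * Real.exp (e * Real.log (singVal B (⌊t⌋₊ + 1))) := by
  have h := singVal_pos hB ((Nat.floor_lt ht).mpr htd)
  rw [svf_of_lt htd, svf_of_lt hed, hfl, mul_assoc, mul_comm e, ← Real.rpow_def_of_pos h,
    ← Real.rpow_add h]
  congr 2
  ring

theorem wordProd_add {d : ℕ} {I : Type*} (A : I → Matrix (Fin d) (Fin d) ℝ) {m n : ℕ}
    (w : Fin (m + n) → I) :
    wordProd A w = wordProd A (w ∘ Fin.castAdd n) * wordProd A (w ∘ Fin.natAdd m) := by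
  simp only [wordProd, List.ofFn_add, List.prod_append, Function.comp_apply]
  rfl

theorem shift_iterate_apply {I : Type*} (x : ℕ → I) (m k : ℕ) : shift^[m] x k = x (m + k) := by
  induction m generalizing x k with
  | zero => simp
  | succ m ih => rw [Function.iterate_succ_apply, ih, shift]; congr 1; omega

theorem restrict_comp_natAdd {I : Type*} (x : ℕ → I) (m n : ℕ) :
    restrict x (m + n) ∘ Fin.natAdd m = restrict (shift^[m] x) n := by
  ext k
  simp [restrict, shift_iterate_apply]

theorem restrict_comp_castAdd {I : Type*} (x : ℕ → I) (m n : ℕ) :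
    restrict x (m + n) ∘ Fin.castAdd n = restrict x m := rfl

theorem wordProd_restrict_add {d : ℕ} {I : Type*} (A : I → Matrix (Fin d) (Fin d) ℝ)
    (x : ℕ → I) (m n : ℕ) :
    wordProd A (restrict x (m + n)) =
      wordProd A (restrict x m) * wordProd A (restrict (shift^[m] x) n) := by
  rw [wordProd_add, restrict_comp_castAdd, restrict_comp_natAdd]

theorem isUnit_wordProd {d : ℕ} {I : Type*} {A : I → Matrix (Fin d) (Fin d) ℝ}
    (hA : ∀ i, IsUnit (A i)) {n : ℕ} (w : Fin n → I) : IsUnit (wordProd A w) := by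
  rw [wordProd]
  refine Submonoid.list_prod_mem (IsUnit.submonoid _) fun B hB => ?_
  obtain ⟨i, rfl⟩ := (List.mem_ofFn' _ _).mp hB
  exact hA _

theorem norm_wordProd_le_one {d : ℕ} {I : Type*} {A : I → Matrix (Fin d) (Fin d) ℝ}
    (hA : ∀ i, ‖Matrix.toEuclideanCLM (n := Fin d) (𝕜 := ℝ) (A i)‖ ≤ 1) {n : ℕ} (w : Fin n → I) :
    ‖Matrix.toEuclideanCLM (n := Fin d) (𝕜 := ℝ) (wordProd A w)‖ ≤ 1 := by
  induction n with
  | zero =>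
    simp only [wordProd, List.ofFn_zero, List.prod_nil, map_one]
    exact ContinuousLinearMap.norm_id_le
  | succ n ih =>
    have h := ih fun k => w k.succ
    simp only [wordProd, List.ofFn_succ, List.prod_cons, map_mul] at h ⊢
    exact (norm_mul_le _ _).trans (mul_le_one₀ (hA _) (norm_nonneg _) h)

theorem pow_le_abs_det_wordProd {d : ℕ} {I : Type*} {A : I → Matrix (Fin d) (Fin d) ℝ} {a : ℝ}
    (ha : 0 ≤ a) (hA : ∀ i, a ≤ |(A i).det|) {n : ℕ} (w : Fin n → I) :
    a ^ n ≤ |(wordProd A w).det| := by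
  induction n with
  | zero => simp [wordProd]
  | succ n ih =>
    have h := ih fun k => w k.succ
    simp only [wordProd, List.ofFn_succ, List.prod_cons, Matrix.det_mul, abs_mul] at h ⊢
    rw [pow_succ']
    exact mul_le_mul (hA _) h (pow_nonneg ha n) (abs_nonneg _)

theorem singularValues_le_one {d : ℕ} {B : Matrix (Fin d) (Fin d) ℝ}
    (hB : ‖Matrix.toEuclideanCLM (n := Fin d) (𝕜 := ℝ) B‖ ≤ 1) (j : ℕ) :
    (Matrix.toEuclideanLin B).singularValues j ≤ 1 :=
  ((Matrix.toEuclideanLin B).singularValues_antitone (Nat.zero_le j)).trans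
    (singularValues_zero_le_one B hB)

theorem abs_det_le_singularValues {d : ℕ} {B : Matrix (Fin d) (Fin d) ℝ}
    (hB : ‖Matrix.toEuclideanCLM (n := Fin d) (𝕜 := ℝ) B‖ ≤ 1) {j : ℕ} (hj : j < d) :
    |B.det| ≤ (Matrix.toEuclideanLin B).singularValues j := by
  rw [← svProd_card_eq_abs_det, svProd, ← Finset.mul_prod_erase _ _ (Finset.mem_range.mpr hj)]
  exact mul_le_of_le_one_right (LinearMap.singularValues_nonneg _ _)
    (Finset.prod_le_one (fun _ _ => LinearMap.singularValues_nonneg _ _)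
      fun i _ => singularValues_le_one hB i)

/-- All singular values are at most 1, so each is at least their product `|det|`, which is at least
the `n`-th power of the smallest `|det (A i)|`. -/
theorem exists_abs_log_singularValues_wordProd_le {d : ℕ} {I : Type*} [Finite I] [Nonempty I]
    {A : I → Matrix (Fin d) (Fin d) ℝ} (hA_inv : ∀ i, IsUnit (A i))
    (hA : ∀ i, ‖Matrix.toEuclideanCLM (n := Fin d) (𝕜 := ℝ) (A i)‖ ≤ 1) :
    ∃ C : ℝ, 0 ≤ C ∧ ∀ (n : ℕ) (w : Fin n → I),
      |Real.log (|(wordProd A w).det|)| ≤ C * n ∧ ∀ j < d,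
      |Real.log ((Matrix.toEuclideanLin (wordProd A w)).singularValues j)| ≤ C * n := by
  obtain ⟨i₀, hi₀⟩ := Finite.exists_min fun i => |(A i).det|
  have ha : 0 < |(A i₀).det| :=
    abs_pos.mpr ((Matrix.isUnit_iff_isUnit_det _).mp (hA_inv i₀)).ne_zero
  refine ⟨|Real.log (|(A i₀).det|)|, abs_nonneg _, fun n w => ?_⟩
  have hw := norm_wordProd_le_one hA w
  have hdet := pow_le_abs_det_wordProd ha.le hi₀ w
  have key : ∀ y : ℝ, |(A i₀).det| ^ n ≤ y → y ≤ 1 →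
      |Real.log y| ≤ |Real.log (|(A i₀).det|)| * n := by
    intro y hy hy1
    have hlow := Real.log_le_log (pow_pos ha n) hy
    rw [Real.log_pow] at hlow
    have hup := Real.log_nonpos ((pow_nonneg ha.le n).trans hy) hy1
    rw [abs_of_nonpos hup]
    have := mul_le_mul_of_nonneg_right (neg_abs_le (Real.log (|(A i₀).det|)))
      (Nat.cast_nonneg (α := ℝ) n)
    linarith
  refine ⟨key _ hdet ?_, fun j hj => key _ (hdet.trans (abs_det_le_singularValues hw hj))
    (singularValues_le_one hw j)⟩
  rw [← svProd_card_eq_abs_det]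
  exact Finset.prod_le_one (fun _ _ => LinearMap.singularValues_nonneg _ _)
      fun i _ => singularValues_le_one hw i

theorem abs_log_svProd_le {d k : ℕ} {B : Matrix (Fin d) (Fin d) ℝ} (hB : IsUnit B) (hk : k ≤ d)
    {y : ℝ} (hy : ∀ j < d, |Real.log ((Matrix.toEuclideanLin B).singularValues j)| ≤ y) :
    |Real.log (svProd k B)| ≤ k * y := by
  rw [svProd, Real.log_prod fun j hj =>
    (singularValues_pos hB ((Finset.mem_range.mp hj).trans_le hk)).ne']
  refine (Finset.abs_sum_le_sum_abs _ _).trans ((Finset.sum_le_sum fun j hj =>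
    hy j ((Finset.mem_range.mp hj).trans_le hk)).trans ?_)
  simp

theorem exists_exp_le_svf_wordProd {d : ℕ} {I : Type*} [Finite I] [Nonempty I]
    {A : I → Matrix (Fin d) (Fin d) ℝ} (hA_inv : ∀ i, IsUnit (A i))
    (hA : ∀ i, ‖Matrix.toEuclideanCLM (n := Fin d) (𝕜 := ℝ) (A i)‖ ≤ 1) {s : ℝ} (hs : 0 ≤ s) :
    ∃ C : ℝ, 0 ≤ C ∧ ∀ (n : ℕ) (w : Fin n → I), Real.exp (-(C * n)) ≤ svf s (wordProd A w) := by
  obtain ⟨C, hC, hCw⟩ := exists_abs_log_singularValues_wordProd_le hA_inv hA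
  by_cases h : s < d
  · have hl : ⌊s⌋₊ < d := (Nat.floor_lt hs).mpr h
    refine ⟨⌊s⌋₊ * C + (s - ⌊s⌋₊) * C, ?_, fun n w => ?_⟩
    · have := sub_nonneg.mpr (Nat.floor_le hs)
      positivity
    have hw := isUnit_wordProd hA_inv w
    have h1 := svProd_pos hw hl.le
    have h2 := singVal_pos hw hl
    rw [svf_of_lt h, ← Real.le_log_iff_exp_le (mul_pos h1 (Real.rpow_pos_of_pos h2 _)),
      Real.log_mul h1.ne' (Real.rpow_pos_of_pos h2 _).ne', Real.log_rpow h2]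
    have h3 := (abs_le.mp (abs_log_svProd_le hw hl.le (hCw n w).2)).1
    have h4 := mul_le_mul_of_nonneg_left (abs_le.mp ((hCw n w).2 _ hl)).1
      (sub_nonneg.mpr (Nat.floor_le hs))
    rw [singVal, Nat.add_sub_cancel]
    linarith
  · refine ⟨s / d * C, by positivity, fun n w => ?_⟩
    have hw : 0 < |(wordProd A w).det| :=
      abs_pos.mpr ((Matrix.isUnit_iff_isUnit_det _).mp (isUnit_wordProd hA_inv w)).ne_zero
    rw [svf, if_neg h, ← Real.le_log_iff_exp_le (Real.rpow_pos_of_pos hw _), Real.log_rpow hw]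
    have h4 := mul_le_mul_of_nonneg_left (abs_le.mp (hCw n w).1).1
      (show 0 ≤ s / d by positivity)
    linarith

/-! ### Existence and midpoint convexity of the pressure -/

theorem words_nonempty {I : Type*} [Fintype I] {K : Set (ℕ → I)} (hK : K.Nonempty) (n : ℕ) :
    (words K n).Nonempty := by
  obtain ⟨x, hx⟩ := hK
  exact ⟨restrict x n, by simpa [words] using ⟨x, hx, rfl⟩⟩

theorem shift_iterate_mem {I : Type*} {K : Set (ℕ → I)} (hK : shift '' K ⊆ K) {x : ℕ → I}
    (hx : x ∈ K) (m : ℕ) : shift^[m] x ∈ K := by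
  induction m with
  | zero => exact hx
  | succ m ih => rw [Function.iterate_succ_apply']; exact hK ⟨_, ih, rfl⟩

theorem sum_svf_pos {d : ℕ} {I : Type*} [Fintype I] {A : I → Matrix (Fin d) (Fin d) ℝ}
    (hA_inv : ∀ i, IsUnit (A i)) {K : Set (ℕ → I)} (hK : K.Nonempty) {s : ℝ} (hs : 0 ≤ s)
    (n : ℕ) : 0 < ∑ w ∈ words K n, svf s (wordProd A w) :=
  Finset.sum_pos (fun w _ => svf_pos (isUnit_wordProd hA_inv w) hs) (words_nonempty hK n)

/-- Cutting a word is injective, and shift invariance of `K` puts the suffix in `K_n`. -/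
theorem sum_svf_add_le {d : ℕ} {I : Type*} [Fintype I] {A : I → Matrix (Fin d) (Fin d) ℝ}
    (hA_inv : ∀ i, IsUnit (A i)) {K : Set (ℕ → I)} (hK : shift '' K ⊆ K) {s : ℝ} (hs : 0 ≤ s)
    (m n : ℕ) :
    ∑ w ∈ words K (m + n), svf s (wordProd A w) ≤
      (∑ w ∈ words K m, svf s (wordProd A w)) * ∑ w ∈ words K n, svf s (wordProd A w) := by
  classical
  set φ : (Fin (m + n) → I) → (Fin m → I) × (Fin n → I) :=
    fun w => (w ∘ Fin.castAdd n, w ∘ Fin.natAdd m)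
  set F : (Fin m → I) × (Fin n → I) → ℝ :=
    fun p => svf s (wordProd A p.1) * svf s (wordProd A p.2)
  have hφ : Function.Injective φ := by
    intro v w h
    obtain ⟨h1, h2⟩ := Prod.mk.inj h
    ext k
    refine Fin.addCases (fun i => congrFun h1 i) (fun i => congrFun h2 i) k
  calc ∑ w ∈ words K (m + n), svf s (wordProd A w)
      ≤ ∑ w ∈ words K (m + n), F (φ w) := by
        refine Finset.sum_le_sum fun w _ => ?_
        rw [wordProd_add]
        exact svf_mul_le (isUnit_wordProd hA_inv _) (isUnit_wordProd hA_inv _) hs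
    _ = ∑ p ∈ (words K (m + n)).image φ, F p := (Finset.sum_image fun v _ w _ h => hφ h).symm
    _ ≤ ∑ p ∈ words K m ×ˢ words K n, F p := by
        refine Finset.sum_le_sum_of_subset_of_nonneg ?_ fun p _ _ =>
          mul_nonneg (svf_pos (isUnit_wordProd hA_inv _) hs).le
            (svf_pos (isUnit_wordProd hA_inv _) hs).le
        intro p hp
        obtain ⟨w, hw, rfl⟩ := Finset.mem_image.mp hp
        obtain ⟨x, hx, rfl⟩ : ∃ x ∈ K, restrict x (m + n) = w := by simpa [words] using hw
        simp only [φ, Finset.mem_product, words, Finset.mem_filter, Finset.mem_univ, true_and]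
        exact ⟨⟨x, hx, rfl⟩, shift^[m] x, shift_iterate_mem hK hx m,
          (restrict_comp_natAdd x m n).symm⟩
    _ = _ := by rw [Finset.sum_mul_sum, Finset.sum_product]

/-- Fekete's lemma. The second part, that the limit is an infimum, gives a bound at each finite `n`,
which allows `n` to be tied to `e` later. -/
theorem tendsto_pressureSeq_and_le {d : ℕ} {I : Type*} [Fintype I] [Nonempty I]
    {A : I → Matrix (Fin d) (Fin d) ℝ} (hA_inv : ∀ i, IsUnit (A i))
    (hA : ∀ i, ‖Matrix.toEuclideanCLM (n := Fin d) (𝕜 := ℝ) (A i)‖ ≤ 1)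
    {K : Set (ℕ → I)} (hK_ne : K.Nonempty) (hK : shift '' K ⊆ K) {s : ℝ} (hs : 0 ≤ s) :
    Tendsto (pressureSeq A K s) atTop (𝓝 (pressure A K s)) ∧
      ∀ n : ℕ, n ≠ 0 →
        n * pressure A K s ≤ Real.log (∑ w ∈ words K n, svf s (wordProd A w)) := by
  set u : ℕ → ℝ := fun n => Real.log (∑ w ∈ words K n, svf s (wordProd A w))
  have hpos := sum_svf_pos hA_inv hK_ne hs
  have hu : Subadditive u := by
    intro m n
    rw [← Real.log_mul (hpos m).ne' (hpos n).ne']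
    exact Real.log_le_log (hpos _) (sum_svf_add_le hA_inv hK hs m n)
  obtain ⟨C, hC, hCw⟩ := exists_exp_le_svf_wordProd hA_inv hA hs
  have hbdd : BddBelow (Set.range fun n : ℕ => u n / n) := by
    refine ⟨-C, ?_⟩
    rintro _ ⟨n, rfl⟩
    rcases Nat.eq_zero_or_pos n with rfl | hn
    · simpa using hC
    have hn' : (0 : ℝ) < n := Nat.cast_pos.mpr hn
    rw [le_div_iff₀ hn', neg_mul, Real.le_log_iff_exp_le (hpos n)]
    obtain ⟨w, hw⟩ := words_nonempty hK_ne n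
    exact (hCw n w).trans (Finset.single_le_sum
      (f := fun w => svf s (wordProd A w))
      (fun w _ => (svf_pos (isUnit_wordProd hA_inv w) hs).le) hw)
  have hseq : pressureSeq A K s = fun n : ℕ => u n / n := by
    ext n
    rw [pressureSeq, one_div_mul_eq_div]
  have hlim : Tendsto (pressureSeq A K s) atTop (𝓝 hu.lim) := hseq ▸ hu.tendsto_lim hbdd
  have hP : pressure A K s = hu.lim := hlim.limUnder_eq
  refine ⟨hP ▸ hlim, fun n hn => ?_⟩
  have := hu.lim_le_div hbdd hn
  rw [hP, mul_comm]
  exact (le_div_iff₀ (Nat.cast_pos.mpr (Nat.pos_of_ne_zero hn))).mp this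

/-- Cauchy–Schwarz: without crossing an integer, `φ^t` is the geometric mean of `φ^{t+e}` and
`φ^{t-e}`. -/
theorem two_mul_pressure_le {d : ℕ} {I : Type*} [Fintype I] [Nonempty I]
    {A : I → Matrix (Fin d) (Fin d) ℝ} (hA_inv : ∀ i, IsUnit (A i))
    (hA : ∀ i, ‖Matrix.toEuclideanCLM (n := Fin d) (𝕜 := ℝ) (A i)‖ ≤ 1)
    {K : Set (ℕ → I)} (hK_ne : K.Nonempty) (hK : shift '' K ⊆ K) {t e : ℝ} (ht : 0 ≤ t)
    (htd : t < d) (h₁ : 0 ≤ t + e) (h₁d : t + e < d) (h₁f : ⌊t + e⌋₊ = ⌊t⌋₊)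
    (h₂ : 0 ≤ t - e) (h₂d : t - e < d) (h₂f : ⌊t - e⌋₊ = ⌊t⌋₊) :
    2 * pressure A K t ≤ pressure A K (t + e) + pressure A K (t - e) := by
  refine le_of_tendsto_of_tendsto'
    ((tendsto_pressureSeq_and_le hA_inv hA hK_ne hK ht).1.const_mul 2)
    ((tendsto_pressureSeq_and_le hA_inv hA hK_ne hK h₁).1.add
      (tendsto_pressureSeq_and_le hA_inv hA hK_ne hK h₂).1) fun n => ?_
  have h0 := sum_svf_pos hA_inv hK_ne ht n
  have hp := sum_svf_pos hA_inv hK_ne h₁ n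
  have hm := sum_svf_pos hA_inv hK_ne h₂ n
  have hcs : (∑ w ∈ words K n, svf t (wordProd A w)) ^ 2 ≤
      (∑ w ∈ words K n, svf (t + e) (wordProd A w)) *
        ∑ w ∈ words K n, svf (t - e) (wordProd A w) := by
    refine Finset.sum_sq_le_sum_mul_sum_of_sq_le_mul _
      (fun w _ => (svf_pos (isUnit_wordProd hA_inv w) h₁).le)
      (fun w _ => (svf_pos (isUnit_wordProd hA_inv w) h₂).le) fun w _ => le_of_eq ?_
    have hw := isUnit_wordProd hA_inv w
    rw [sub_eq_add_neg] at h₂d h₂f ⊢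
    rw [svf_add_eq hw ht htd h₁d h₁f, svf_add_eq hw ht htd h₂d h₂f, mul_mul_mul_comm,
      ← Real.exp_add]
    simp [sq]
  have hlog := Real.log_le_log (pow_pos h0 2) hcs
  rw [Real.log_pow, Real.log_mul hp.ne' hm.ne'] at hlog
  simp only [pressureSeq]
  rw [← mul_add, mul_left_comm]
  exact mul_le_mul_of_nonneg_left (by exact_mod_cast hlog) (by positivity)

/-! ### From one-sided estimates to the derivative -/

/-- The upper bound at `-e`, inserted in the midpoint inequality, is the lower bound at `e`. -/
theorem hasDerivAt_of_midpoint_le_of_le {P : ℝ → ℝ} {t l r : ℝ} (hr : 0 < r)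
    (hmid : ∀ e, |e| < r → 2 * P t ≤ P (t + e) + P (t - e))
    (hup : ∀ ε, 0 < ε → ∃ δ, 0 < δ ∧ ∀ e, e ≠ 0 → |e| < δ → P (t + e) - P t ≤ e * l + |e| * ε) :
    HasDerivAt P l t := by
  rw [hasDerivAt_iff_isLittleO_nhds_zero, Asymptotics.isLittleO_iff]
  intro ε hε
  obtain ⟨δ, hδ, hδe⟩ := hup ε hε
  filter_upwards [Metric.ball_mem_nhds (0 : ℝ) (lt_min hr hδ)] with e he
  rw [Metric.mem_ball, dist_zero_right, Real.norm_eq_abs, lt_min_iff] at he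
  rcases eq_or_ne e 0 with rfl | he0
  · simp
  have h1 := hmid e he.1
  have h2 := hδe e he0 he.2
  have h3 := hδe (-e) (neg_ne_zero.mpr he0) (by rw [abs_neg]; exact he.2)
  rw [abs_neg, ← sub_eq_add_neg] at h3
  rw [Real.norm_eq_abs, Real.norm_eq_abs, smul_eq_mul, abs_le]
  constructor <;> linarith

theorem exists_forall_sub_le_of_forall_nat_mul_sub_le {P : ℝ → ℝ} {t l r b : ℝ} (hr : 0 < r)
    (hb : 0 ≤ b) {η : ℕ → ℝ} (hη : Tendsto η atTop (𝓝 0))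
    (hbound : ∀ R, 0 ≤ R → ∃ D, ∀ (e : ℝ) (n : ℕ), |e| < r → n ≠ 0 → n * |e| ≤ R + 1 →
      n * (P (t + e) - P t) ≤ b + n * (e * l) + D * η n) {ε : ℝ} (hε : 0 < ε) :
    ∃ δ, 0 < δ ∧ ∀ e, e ≠ 0 → |e| < δ → P (t + e) - P t ≤ e * l + |e| * ε := by
  -- Chosen so that `b + ε / 2 = R * (ε / 2)`, which `n * |e| ≥ R` absorbs into `n * |e| * (ε / 2)`.
  set R := 2 * b / ε + 1
  have hR : 0 < R := by positivity
  obtain ⟨D, hD⟩ := hbound R hR.le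
  have hDη : Tendsto (fun n => D * η n) atTop (𝓝 0) := by simpa using hη.const_mul D
  obtain ⟨N, hN⟩ := eventually_atTop.mp
    (hDη.eventually (gt_mem_nhds (show (0 : ℝ) < ε / 2 by linarith)))
  -- With `n = ⌈R / |e|⌉₊`, the bound by 1 gives `n * |e| ≤ R + 1`, and the bound by `R / (N + 1)`
  -- gives `n ≥ N`.
  refine ⟨min (min r 1) (R / (N + 1)), by positivity, fun e he0 he => ?_⟩
  rw [lt_min_iff, lt_min_iff] at he
  obtain ⟨⟨her, he1⟩, heN⟩ := he
  have hepos : 0 < |e| := abs_pos.mpr he0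
  set n := ⌈R / |e|⌉₊
  have hn1 : R / |e| ≤ n := Nat.le_ceil _
  have hn2 : (n : ℝ) < R / |e| + 1 := Nat.ceil_lt_add_one (by positivity)
  have hnpos : (0 : ℝ) < n := lt_of_lt_of_le (by positivity) hn1
  have hn0 : n ≠ 0 := by exact_mod_cast hnpos.ne'
  have hRn : R ≤ n * |e| := (div_le_iff₀ hepos).mp hn1
  have hnR : n * |e| ≤ R + 1 := by
    have := mul_le_mul_of_nonneg_right hn2.le hepos.le
    rw [add_mul, div_mul_cancel₀ _ hepos.ne', one_mul] at this
    linarith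
  have hNn : N ≤ n := by
    have h1 : (N : ℝ) + 1 < R / |e| := by
      rw [lt_div_iff₀ hepos]
      rwa [lt_div_iff₀ (by positivity), mul_comm] at heN
    have h2 : (N : ℝ) ≤ n := by linarith
    exact_mod_cast h2
  have h1 := hD e n her hn0 hnR
  have h2 := hN n hNn
  have h3 : b + ε / 2 = R * (ε / 2) := by
    simp only [R]
    field_simp
  have h4 : R * (ε / 2) ≤ n * |e| * (ε / 2) := mul_le_mul_of_nonneg_right hRn (by linarith)
  have h5 : 0 ≤ n * |e| * (ε / 2) := by positivity
  refine le_of_mul_le_mul_left ?_ hnpos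
  linarith

theorem exp_le_one_add_abs_mul_exp {u b : ℝ} (hu : |u| ≤ b) :
    Real.exp u ≤ 1 + |u| * Real.exp b := by
  have h1 : Real.exp u ≤ 1 + u * Real.exp u := by
    have h := mul_le_mul_of_nonneg_left (Real.add_one_le_exp (-u)) (Real.exp_pos u).le
    rw [← Real.exp_add, add_neg_cancel, Real.exp_zero] at h
    linarith
  have h2 : u * Real.exp u ≤ |u| * Real.exp b :=
    mul_le_mul (le_abs_self u) (Real.exp_le_exp.mpr ((le_abs_self u).trans hu))
      (Real.exp_pos u).le (abs_nonneg u)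
  linarith

/-- The exponent differs from `n * (e * l)` by `n * e * (f / n - l)`, bounded by `R * (C + |l|)`. On
that range `exp` is at most linear in the deviation, so only its L¹ norm enters; `1 + y ≤ exp y`
restores an exponential. -/
theorem integral_exp_mul_le {Ω : Type*} [MeasurableSpace Ω] {μ : Measure Ω}
    [IsProbabilityMeasure μ] {f : Ω → ℝ} (hf : Measurable f) {C l R e : ℝ} {n : ℕ} (hn : n ≠ 0)
    (hfC : ∀ x, |f x| ≤ C * n) (he : n * |e| ≤ R) :
    ∫ x, Real.exp (e * f x) ∂μ ≤ Real.exp (n * (e * l) +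
      R * Real.exp (R * (C + |l|)) * ∫ x, |f x / n - l| ∂μ) := by
  have hn' : (0 : ℝ) < n := Nat.cast_pos.mpr (Nat.pos_of_ne_zero hn)
  have hdiff : ∀ x, |f x / n - l| ≤ C + |l| := fun x => by
    refine (abs_sub _ _).trans (add_le_add ?_ le_rfl)
    rw [abs_div, abs_of_pos hn']
    exact (div_le_iff₀ hn').mpr (hfC x)
  have hu : ∀ x, |e * f x - n * (e * l)| ≤ R * |f x / n - l| := fun x => by
    have : e * f x - n * (e * l) = n * e * (f x / n - l) := by field_simp
    rw [this, abs_mul, abs_mul, abs_of_pos hn']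
    exact mul_le_mul_of_nonneg_right he (abs_nonneg _)
  have hR : 0 ≤ R := le_trans (by positivity) he
  have hpt : ∀ x, Real.exp (e * f x) ≤ Real.exp (n * (e * l)) *
      (1 + R * Real.exp (R * (C + |l|)) * |f x / n - l|) := fun x => by
    have h1 := exp_le_one_add_abs_mul_exp
      ((hu x).trans (mul_le_mul_of_nonneg_left (hdiff x) hR))
    have h2 := mul_le_mul_of_nonneg_right (hu x) (Real.exp_pos (R * (C + |l|))).le
    have h3 : Real.exp (e * f x) = Real.exp (n * (e * l)) * Real.exp (e * f x - n * (e * l)) := by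
      rw [← Real.exp_add]
      congr 1
      ring
    rw [h3]
    refine mul_le_mul_of_nonneg_left ?_ (Real.exp_pos _).le
    linarith
  have hint : Integrable (fun x => |f x / n - l|) μ :=
    Integrable.of_bound ((hf.div_const _).sub_const _).abs.aestronglyMeasurable (C + |l|)
      (ae_of_all _ fun x => by rw [Real.norm_eq_abs, abs_abs]; exact hdiff x)
  have hintR : Integrable (fun x => 1 + R * Real.exp (R * (C + |l|)) * |f x / n - l|) μ :=
    (integrable_const 1).add (hint.const_mul _)
  have h1 := integral_mono_of_nonneg (μ := μ) (ae_of_all _ fun x => (Real.exp_pos (e * f x)).le)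
    (hintR.const_mul (Real.exp (n * (e * l)))) (ae_of_all _ hpt)
  rw [integral_const_mul, integral_add (integrable_const 1) (hint.const_mul _),
    integral_const_mul] at h1
  simp only [integral_const, probReal_univ, one_smul] at h1
  refine h1.trans ?_
  rw [Real.exp_add]
  refine mul_le_mul_of_nonneg_left ?_ (Real.exp_pos _).le
  rw [add_comm]
  exact Real.add_one_le_exp _

/-! ### Cylinder sums as integrals, and Lyapunov exponents -/

theorem measurable_restrict {I : Type*} [MeasurableSpace I] (n : ℕ) :
    Measurable fun x : ℕ → I => restrict x n :=
  measurable_pi_iff.mpr fun k => measurable_pi_apply (k : ℕ)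

theorem sum_words_eq_integral {I : Type*} [Fintype I] [MeasurableSpace I]
    [MeasurableSingletonClass I] {K : Set (ℕ → I)} {μ : Measure (ℕ → I)} [IsFiniteMeasure μ]
    (hμ : μ Kᶜ = 0) (n : ℕ) (F : (Fin n → I) → ℝ) :
    ∑ w ∈ words K n, μ.real (cylinder w) * F w = ∫ x, F (restrict x n) ∂μ := by
  have hF : AEStronglyMeasurable F (μ.map fun x => restrict x n) :=
    (measurable_of_finite F).aestronglyMeasurable
  rw [← integral_map (measurable_restrict n).aemeasurable hF, integral_fintype Integrable.of_finite,
    ← Finset.sum_subset (Finset.subset_univ (words K n))]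
  · refine Finset.sum_congr rfl fun w _ => ?_
    rw [map_measureReal_apply (measurable_restrict n) (measurableSet_singleton w), smul_eq_mul]
    rfl
  · intro w _ hw
    have : (fun x : ℕ → I => restrict x n) ⁻¹' {w} ⊆ Kᶜ := by
      intro x hx hxK
      exact hw (by simpa [words] using ⟨x, hxK, hx⟩)
    rw [map_measureReal_apply (measurable_restrict n) (measurableSet_singleton w),
      measureReal_def, measure_mono_null this hμ]
    simp

/-- The logarithm of a single singular value need not be subadditive, but it is the difference of
two subadditive sequences, the logarithms of `svProd (k + 1)` and `svProd k`. -/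
theorem exists_tendsto_integral_abs_log_singVal_sub {d : ℕ} {I : Type*} [Finite I] [Nonempty I]
    [MeasurableSpace I] [MeasurableSingletonClass I]
    {A : I → Matrix (Fin d) (Fin d) ℝ} (hA_inv : ∀ i, IsUnit (A i))
    (hA : ∀ i, ‖Matrix.toEuclideanCLM (n := Fin d) (𝕜 := ℝ) (A i)‖ ≤ 1)
    {μ : Measure (ℕ → I)} [IsProbabilityMeasure μ] (hμ : Ergodic shift μ) {k : ℕ} (hk : k < d) :
    ∃ l, Tendsto (fun n : ℕ =>
      ∫ x, |Real.log (singVal (wordProd A (restrict x n)) (k + 1)) / n - l| ∂μ) atTop (𝓝 0) := by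
  obtain ⟨C, hC, hCw⟩ := exists_abs_log_singularValues_wordProd_le hA_inv hA
  set g : ℕ → ℕ → (ℕ → I) → ℝ := fun j n x => Real.log (svProd j (wordProd A (restrict x n)))
  have hgm : ∀ j n, Measurable (g j n) := fun j n =>
    (measurable_of_finite fun w => Real.log (svProd j (wordProd A w))).comp (measurable_restrict n)
  have hgb : ∀ j ≤ d, ∀ n x, |g j n x| ≤ (j * C) * n := fun j hj n x => by
    rw [mul_assoc]
    exact abs_log_svProd_le (isUnit_wordProd hA_inv _) hj (hCw n _).2
  have hgs : ∀ j ≤ d, ∀ m n x, g j (m + n) x ≤ g j m x + g j n (shift^[m] x) := by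
    intro j hj m n x
    have h1 := svProd_pos (isUnit_wordProd hA_inv (restrict x m)) hj
    have h2 := svProd_pos (isUnit_wordProd hA_inv (restrict (shift^[m] x) n)) hj
    simp only [g]
    rw [← Real.log_mul h1.ne' h2.ne']
    refine Real.log_le_log (svProd_pos (isUnit_wordProd hA_inv _) hj) ?_
    rw [wordProd_restrict_add]
    exact svProd_mul_le hj _ _
  obtain ⟨γ₀, h₀⟩ := hμ.exists_tendsto_integral_abs_sub_of_subadditive (hgm k) (hgb k hk.le)
    (hgs k hk.le)
  obtain ⟨γ₁, h₁⟩ := hμ.exists_tendsto_integral_abs_sub_of_subadditive (hgm (k + 1))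
    (hgb (k + 1) hk) (hgs (k + 1) hk)
  have hint : ∀ j ≤ d, ∀ n γ, Integrable (fun x => |g j n x / n - γ|) μ := fun j hj n γ =>
    ((((Integrable.of_bound (hgm j n).aestronglyMeasurable _
      (ae_of_all _ fun x => hgb j hj n x)).div_const _)).sub (integrable_const γ)).abs
  refine ⟨γ₁ - γ₀, squeeze_zero (fun n => integral_nonneg fun x => abs_nonneg _) (fun n => ?_)
    (by simpa using h₁.add h₀)⟩
  rw [← integral_add (hint _ hk n γ₁) (hint _ hk.le n γ₀)]
  refine integral_mono_of_nonneg (ae_of_all _ fun x => abs_nonneg _)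
    ((hint _ hk n γ₁).add (hint _ hk.le n γ₀)) (ae_of_all _ fun x => ?_)
  have hw := isUnit_wordProd hA_inv (restrict x n)
  have : Real.log (singVal (wordProd A (restrict x n)) (k + 1)) = g (k + 1) n x - g k n x := by
    simp only [g]
    rw [svProd_succ, Real.log_mul (svProd_pos hw hk.le).ne' (singVal_pos hw hk).ne']
    ring
  simp only [this]
  rw [show (g (k + 1) n x - g k n x) / n - (γ₁ - γ₀) =
    (g (k + 1) n x / n - γ₁) - (g k n x / n - γ₀) by ring]
  exact abs_sub _ _

end SubSelfAffine

/-! ### Proof of the theorem -/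

theorem mainTheorem4 {d : ℕ} {I : Type*} [Fintype I] [TopologicalSpace I] [DiscreteTopology I]
    [MeasurableSpace I] [BorelSpace I] (hI : 2 ≤ Fintype.card I)
    (A : I → Matrix (Fin d) (Fin d) ℝ) (hA_inv : ∀ i, IsUnit (A i))
    (hA_contr : ∀ i, ‖Matrix.toEuclideanCLM (n := Fin d) (𝕜 := ℝ) (A i)‖ < 1)
    (K : Set (ℕ → I)) (hK_ne : K.Nonempty) (hK_compact : IsCompact K)
    (hK_shift : SubSelfAffine.shift '' K ⊆ K)
    (t : ℝ) (ht_pos : 0 < t) (ht_lt : t < d) (ht_nonint : ∀ k : ℕ, t ≠ k)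
    (c : ℝ) (hc : 1 ≤ c)
    (μ : Measure (ℕ → I)) [IsProbabilityMeasure μ] (hμ_erg : Ergodic SubSelfAffine.shift μ)
    (hμ_supp : μ.support ⊆ K)
    (hμ_gibbs : ∀ n : ℕ, 1 ≤ n → ∀ w ∈ SubSelfAffine.words K n,
      c⁻¹ * Real.exp (-(n : ℝ) * SubSelfAffine.pressure A K t)
          * SubSelfAffine.svf t (SubSelfAffine.wordProd A w)
        ≤ μ.real (SubSelfAffine.cylinder w)) :
    (∀ s : ℝ, 0 ≤ s →
      Tendsto (SubSelfAffine.pressureSeq A K s) atTop (𝓝 (SubSelfAffine.pressure A K s))) ∧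
    Tendsto (SubSelfAffine.lyapunovSeq A K μ (⌊t⌋₊ + 1)) atTop
      (𝓝 (SubSelfAffine.lyapunov A K μ (⌊t⌋₊ + 1))) ∧
    HasDerivAt (SubSelfAffine.pressure A K) (SubSelfAffine.lyapunov A K μ (⌊t⌋₊ + 1)) t := by
  open SubSelfAffine in
  have : Nonempty I := Fintype.card_pos_iff.mp (by omega)
  have hA := fun i => (hA_contr i).le
  have hpress := fun s (hs : 0 ≤ s) =>
    tendsto_pressureSeq_and_le hA_inv hA hK_ne hK_shift hs
  have hk : ⌊t⌋₊ < d := (Nat.floor_lt ht_pos.le).mpr ht_lt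
  have hμK : μ Kᶜ = 0 :=
    measure_mono_null (Set.compl_subset_compl.mpr hμ_supp) Measure.measure_compl_support
  obtain ⟨C, hC, hCw⟩ := exists_abs_log_singularValues_wordProd_le hA_inv hA
  obtain ⟨l, hl⟩ := exists_tendsto_integral_abs_log_singVal_sub hA_inv hA hμ_erg hk
  set f : ℕ → (ℕ → I) → ℝ :=
    fun n x => Real.log (singVal (wordProd A (restrict x n)) (⌊t⌋₊ + 1))
  have hfm : ∀ n, Measurable (f n) := fun n =>
    (measurable_of_finite fun w => Real.log (singVal (wordProd A w) (⌊t⌋₊ + 1))).comp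
      (measurable_restrict n)
  have hfC : ∀ n x, |f n x| ≤ C * n := fun n x => (hCw n (restrict x n)).2 _ hk
  have hfi : ∀ n, Integrable (f n) μ := fun n =>
    Integrable.of_bound (hfm n).aestronglyMeasurable (C * n) (ae_of_all _ fun x => hfC n x)
  have hlyap : Tendsto (lyapunovSeq A K μ (⌊t⌋₊ + 1)) atTop (𝓝 l) := by
    rw [tendsto_iff_norm_sub_tendsto_zero]
    refine squeeze_zero (fun n => norm_nonneg _) (fun n => ?_) hl
    have h1 : lyapunovSeq A K μ (⌊t⌋₊ + 1) n - l = ∫ x, (f n x / n - l) ∂μ := by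
      rw [lyapunovSeq, sum_words_eq_integral hμK n
        (fun w => Real.log (singVal (wordProd A w) (⌊t⌋₊ + 1))),
        integral_sub ((hfi n).div_const _) (integrable_const l), integral_div,
        one_div_mul_eq_div]
      simp [f]
    rw [h1, Real.norm_eq_abs]
    exact abs_integral_le_integral_abs
  have hlyap_eq : lyapunov A K μ (⌊t⌋₊ + 1) = l := hlyap.limUnder_eq
  refine ⟨fun s hs => (hpress s hs).1, hlyap_eq ▸ hlyap, ?_⟩
  rw [hlyap_eq]
  have hfloor : (⌊t⌋₊ : ℝ) < t := (Nat.floor_le ht_pos.le).lt_of_ne (ht_nonint _).symm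
  have hfloor' := Nat.lt_floor_add_one t
  have hkd : (⌊t⌋₊ : ℝ) + 1 ≤ d := by exact_mod_cast hk
  -- Distance from `t` to the integers; it is positive as `t` is not an integer, and smaller
  -- perturbations keep the floor.
  set r := min (t - ⌊t⌋₊) (⌊t⌋₊ + 1 - t)
  have hr : 0 < r := lt_min (by linarith) (by linarith)
  have hnear : ∀ e, |e| < r → 0 ≤ t + e ∧ t + e < d ∧ ⌊t + e⌋₊ = ⌊t⌋₊ := by
    intro e he
    obtain ⟨h1, h2⟩ := lt_min_iff.mp he
    have h3 := neg_abs_le e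
    have h4 := le_abs_self e
    have h5 : (0 : ℝ) ≤ ⌊t⌋₊ := Nat.cast_nonneg _
    have h6 : 0 ≤ t + e := by linarith
    refine ⟨h6, by linarith, (Nat.floor_eq_iff h6).mpr ⟨by linarith, by linarith⟩⟩
  refine hasDerivAt_of_midpoint_le_of_le hr (fun e he => ?_) fun ε hε =>
    exists_forall_sub_le_of_forall_nat_mul_sub_le hr (Real.log_nonneg hc) hl
      -- The constant of `integral_exp_mul_le` with `R + 1` in place of `R`, since rounding `n` up
      -- only ensures `n * |e| ≤ R + 1`.
      (fun R hR => ⟨(R + 1) * Real.exp ((R + 1) * (C + |l|)), fun e n he hn hne => ?_⟩) hε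
  · obtain ⟨h1, h1d, h1f⟩ := hnear e he
    obtain ⟨h2, h2d, h2f⟩ := hnear (-e) (by rwa [abs_neg])
    rw [← sub_eq_add_neg] at h2 h2d h2f
    exact two_mul_pressure_le hA_inv hA hK_ne hK_shift ht_pos.le ht_lt h1 h1d h1f h2 h2d h2f
  · obtain ⟨h1, h1d, h1f⟩ := hnear e he
    have hc0 : 0 < c := by linarith
    -- The Gibbs bound read as `φ^t ≤ c * exp (n P(t)) * μ[w]` turns the partition function at `t +
    -- e` into an exponential moment.
    have hZ : ∑ w ∈ words K n, svf (t + e) (wordProd A w) ≤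
        c * Real.exp (n * pressure A K t) * ∫ x, Real.exp (e * f n x) ∂μ := by
      rw [← sum_words_eq_integral hμK n
        (fun w => Real.exp (e * Real.log (singVal (wordProd A w) (⌊t⌋₊ + 1)))), Finset.mul_sum]
      refine Finset.sum_le_sum fun w hw => ?_
      rw [svf_add_eq (isUnit_wordProd hA_inv w) ht_pos.le ht_lt h1d h1f, ← mul_assoc]
      refine mul_le_mul_of_nonneg_right ?_ (Real.exp_pos _).le
      have h := mul_le_mul_of_nonneg_left (hμ_gibbs n (Nat.pos_of_ne_zero hn) w hw)
        (mul_pos hc0 (Real.exp_pos (n * pressure A K t))).le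
      refine le_trans (le_of_eq ?_) h
      rw [neg_mul, Real.exp_neg]
      field_simp
    have hexp := integral_exp_mul_le (μ := μ) (l := l) (hfm n) hn (hfC n) hne
    have hle := hZ.trans (mul_le_mul_of_nonneg_left hexp (by positivity))
    have hlog := ((hpress (t + e) h1).2 n hn).trans
      (Real.log_le_log (sum_svf_pos hA_inv hK_ne h1 n) hle)
    rw [Real.log_mul (by positivity) (Real.exp_pos _).ne',
      Real.log_mul hc0.ne' (Real.exp_pos _).ne', Real.log_exp, Real.log_exp] at hlog
    linarith
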